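/- Let $\mathrm{SmCat}$ be the category of small categories and functors, with the Joyal–Tierney (canonical) model structure: the cofibrations are the functors that are injective on objects, the weak equivalences are the equivalences of categories, and the fibrations are the functors with the right lifting property against all acyclic cofibrations (equivalently, the isofibrations). Write $1$ for the terminal category. Definitions. - An object $W$ is a homotopy pushout of $Z\xleftarrow{f}X\xrightarrow{g}Y$ if there are acyclic fibrations $\tilde X\to X$, $\tilde Y\to Y$, $\tilde Z\to Z$ with $\tilde X$ cofibrant, and cofibrations $\tilde X\to\tilde Z$, $\tilde X\to\tilde Y$ lying over $f$ and $g$, such that $W$ is a pushout of $\tilde Z\leftarrow\tilde X\to\tilde Y$. - For $X$ cofibrant, $W$ is a one-sided homotopy pushout of $f:X\to Z$ along $g:X\to Y$ if $g$ factors as a cofibration $X\to\tilde Y$ followed by an acyclic fibration $\tilde Y\to Y$ such that $W$ is a pushout of $Z\xleftarrow{f}X\to\tilde Y$. - The $0$-sphere is $1\amalg 1$ (up to isomorphism). For $n\ge 1$, an $n$-sphere is a homotopy pushout of $1\leftarrow S\to 1$ with $S$ an $(n-1)$-sphere. - A $0$-dimensional CW-complex is a cofibrant object that is a coproduct of copies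 of $1$. For $n\ge1$, an $n$-dimensional CW-complex is a one-sided homotopy pushout of a map $\coprod_{i\in I}S_i\to Y$ along the canonical map $\coprod_{i\in I}S_i\to\coprod_{i\in I}1$, where $I$ is a set, each $S_i$ is an $(n-1)$-sphere and $Y$ is an $(n-1)$-dimensional CW-complex. Theorem. For every small category $\mathcal{X}$, the following are equivalent: 1. $\mathcal{X}$ is a $2$-dimensional CW-complex in $\mathrm{SmCat}$; 2. $\mathcal{X}$ is weakly equivalent (connected by a finite zigzag of weak equivalences) to a $2$-dimensional CW-complex in $\mathrm{SmCat}$; 3. $\mathcal{X}$ is a groupoid. -/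

import Mathlib

universe v u

open CategoryTheory Limits HomotopicalAlgebra

namespace FormalCW

section General

/-! Spheres and CW-complexes in a category with cofibrations, fibrations and weak equivalences. -/

variable {C : Type u} [Category.{v} C]
  [CategoryWithCofibrations C] [CategoryWithFibrations C] [CategoryWithWeakEquivalences C]

/-- `W` is a homotopy pushout of the span `Z ← X → Y` with legs `f` and `g`: the span is replaced,
along acyclic fibrations, by a span of cofibrations out of a cofibrant object, and `W` is a pushout
of the replacement. -/
def IsHomotopyPushout [HasInitial C] {X Y Z : C} (f : X ⟶ Z) (g : X ⟶ Y) (W : C) : Prop :=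
  ∃ (X' Y' Z' : C) (f' : X' ⟶ Z') (g' : X' ⟶ Y') (inl : Z' ⟶ W) (inr : Y' ⟶ W)
    (pX : X' ⟶ X) (pY : Y' ⟶ Y) (pZ : Z' ⟶ Z),
    IsCofibrant X' ∧ Cofibration f' ∧ Cofibration g' ∧
    trivialFibrations C pX ∧ trivialFibrations C pY ∧ trivialFibrations C pZ ∧
    f' ≫ pZ = pX ≫ f ∧ g' ≫ pY = pX ≫ g ∧
    IsPushout f' g' inl inr

/-- `W` is a one-sided homotopy pushout of `f : X ⟶ Z` along `g : X ⟶ Y`, with `X` cofibrant: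
only `g` is replaced by a cofibration `g' : X ⟶ Y'`, where `g` is `g'` followed by an acyclic
fibration. -/
def IsOneSidedHomotopyPushout [HasInitial C] {X Y Z : C} (f : X ⟶ Z) (g : X ⟶ Y) (W : C) : Prop :=
  IsCofibrant X ∧
  ∃ (Y' : C) (g' : X ⟶ Y') (p : Y' ⟶ Y) (inl : Z ⟶ W) (inr : Y' ⟶ W),
    Cofibration g' ∧ trivialFibrations C p ∧ g' ≫ p = g ∧ IsPushout f g' inl inr

/-- `IsSphere n X`: the object `X` is an `n`-sphere. -/
def IsSphere [HasInitial C] [HasTerminal C] [HasBinaryCoproducts C] : ℕ → C → Prop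
  | 0, X => Nonempty (X ≅ (⊤_ C) ⨿ (⊤_ C))
  | n + 1, X => ∃ Y : C, IsSphere n Y ∧
      IsHomotopyPushout (terminal.from Y) (terminal.from Y) X

/-- `IsCWComplex n X`: the object `X` is an `n`-dimensional CW-complex. -/
def IsCWComplex [HasInitial C] [HasTerminal C] [HasBinaryCoproducts C] [HasCoproducts.{v} C] :
    ℕ → C → Prop
  | 0, X => IsCofibrant X ∧ ∃ I : Type v, Nonempty (X ≅ ∐ fun _ : I => ⊤_ C)
  | n + 1, X => ∃ (I : Type v) (S : I → C) (Y : C) (f : ∐ S ⟶ Y),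
      (∀ i, IsSphere n (S i)) ∧ IsCWComplex n Y ∧
      IsOneSidedHomotopyPushout f
        (Limits.Sigma.map fun i => terminal.from (S i) : ∐ S ⟶ ∐ fun _ : I => ⊤_ C) X

/-- Two objects are weakly equivalent if a finite zigzag of weak equivalences connects them. -/
def WeaklyEquivalent (X Y : C) : Prop :=
  Relation.EqvGen (fun A B : C => ∃ f : A ⟶ B, WeakEquivalence f) X Y

end General

section JoyalTierney

/-! The three classes of the Joyal–Tierney model structure on small categories. -/

/-- Cofibrations: the functors that are injective on objects. -/
instance : CategoryWithCofibrations Cat.{v, u} where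
  cofibrations _ _ F := Function.Injective F.toFunctor.obj

/-- Weak equivalences: the equivalences of categories. -/
instance : CategoryWithWeakEquivalences Cat.{v, u} where
  weakEquivalences _ _ F := F.toFunctor.IsEquivalence

/-- Fibrations: the functors with the right lifting property against all acyclic cofibrations. -/
instance : CategoryWithFibrations Cat.{v, u} where
  fibrations := (trivialCofibrations Cat.{v, u}).rlp

end JoyalTierney

end FormalCW

namespace FormalCW

/-! A functor from a groupoid factors uniquely through the core of its target, so any colimit in
`Cat` of groupoids is a groupoid (`isGroupoid_of_isColimit`). Equivalences preserve and reflect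
being a groupoid. Hence spheres, CW-complexes of every dimension, and everything weakly equivalent
to them are groupoids.

Conversely, a groupoid `X` is built from its tautological presentation. The vertices are its
objects; attaching an edge for every morphism gives the free groupoid `skeleton X`; attaching a
2-cell for every pair of parallel morphisms of the skeleton with equal value in `X` imposes all
relations. Cells may be modelled by the free-living isomorphism `Interval`: it is equivalent to `1`,
and both its pair of ends and the folding of the circle onto it are injective on objects, hence
cofibrations. A pushout along `circle.fold` makes two parallel isomorphisms equal and changes no
objects, so the result is `X` itself and not merely a category equivalent to it
(`presentation_isPushout`). The universal property holds because `skeletonMap` is full and bijective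
on objects, so that functors out of `X` are the functors out of the skeleton that respect the
relations. -/

/-! ### Indiscrete categories and functors out of the free-living isomorphism -/

/-- The category with objects `α` and exactly one morphism between any two objects. -/
structure Indiscrete (α : Type u) : Type u where
  /-- The underlying element. -/
  as : α

namespace Indiscrete

instance category (α : Type u) : Category.{v} (Indiscrete α) where
  Hom _ _ := PUnit.{v + 1}
  id _ := ⟨⟩
  comp _ _ := ⟨⟩

instance (α : Type u) (x y : Indiscrete.{u} α) : Subsingleton (x ⟶ y) :=
  inferInstanceAs (Subsingleton PUnit)

/-- The functor to an indiscrete category given by a function on objects. -/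
def functor {α : Type u} {C : Type u} [Category.{v} C] (φ : C → α) :
    C ⥤ Indiscrete α where
  obj x := ⟨φ x⟩
  map _ := PUnit.unit

lemma functor_ext {α : Type u} {C : Type u} [Category.{v} C] {F G : C ⥤ Indiscrete α}
    (h : ∀ x, F.obj x = G.obj x) : F = G :=
  CategoryTheory.Functor.ext h fun _ _ _ => Subsingleton.elim _ _

/-- A functor out of an indiscrete category, from a family of isomorphisms with common source. -/
def functorOfIsos {α : Type u} {T : Type u} [Category.{v} T] {t : T} (φ : α → T)
    (e : ∀ x, t ≅ φ x) : Indiscrete α ⥤ T where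
  obj x := φ x.as
  map {x y} _ := (e x.as).inv ≫ (e y.as).hom

end Indiscrete

/-- The category freely generated by an isomorphism `src ≅ tgt`. -/
abbrev Interval : Cat.{u, u} := Cat.of (Indiscrete.{u} (ULift.{u} Bool))

namespace Interval

/-- The source of the generating isomorphism. -/
abbrev src : Interval.{u} := ⟨⟨false⟩⟩

/-- The target of the generating isomorphism. -/
abbrev tgt : Interval.{u} := ⟨⟨true⟩⟩

/-- The generating isomorphism. -/
abbrev arrow : src.{u} ⟶ tgt.{u} := PUnit.unit

variable {T T' : Cat.{u, u}}

/-- The isomorphisms to the two ends of an isomorphism from its source. -/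
def fan {a b : T} (e : a ≅ b) : ∀ x : ULift.{u} Bool, a ≅ (bif x.down then b else a)
  | ⟨false⟩ => Iso.refl a
  | ⟨true⟩ => e

/-- The functor out of the interval classifying an isomorphism. -/
def ofIso {a b : T} (e : a ≅ b) : Interval.{u} ⟶ T :=
  (Indiscrete.functorOfIsos _ (fan e)).toCatHom

lemma ofIso_arrow {a b : T} (e : a ≅ b) : (ofIso e).toFunctor.map arrow = e.hom :=
  Category.id_comp e.hom

lemma ofIso_comp {a b : T} (e : a ≅ b) (F : T ⟶ T') :
    ofIso e ≫ F = ofIso (F.toFunctor.mapIso e) := by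
  apply Cat.Hom.ext
  refine CategoryTheory.Functor.ext ?_ ?_
  · rintro ⟨⟨_ | _⟩⟩ <;> rfl
  · rintro ⟨⟨_ | _⟩⟩ ⟨⟨_ | _⟩⟩ f
    · change F.toFunctor.map (𝟙 a ≫ 𝟙 a) = 𝟙 _ ≫ (𝟙 _ ≫ 𝟙 _) ≫ 𝟙 _
      simp
    · change F.toFunctor.map (𝟙 a ≫ e.hom) = 𝟙 _ ≫ (𝟙 _ ≫ F.toFunctor.map e.hom) ≫ 𝟙 _
      simp
    · change F.toFunctor.map (e.inv ≫ 𝟙 a) = 𝟙 _ ≫ (F.toFunctor.map e.inv ≫ 𝟙 _) ≫ 𝟙 _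
      simp
    · change F.toFunctor.map (e.inv ≫ e.hom) =
        𝟙 _ ≫ (F.toFunctor.map e.inv ≫ F.toFunctor.map e.hom) ≫ 𝟙 _
      simp

/-- Functors identify isomorphisms whose classifying functors they identify. -/
lemma map_eq_of_ofIso_comp_eq {a b : T} {e e' : a ≅ b} {F : T ⟶ T'}
    (h : ofIso e ≫ F = ofIso e' ≫ F) : F.toFunctor.map e.hom = F.toFunctor.map e'.hom := by
  rw [ofIso_comp, ofIso_comp] at h
  have := Functor.congr_hom (congrArg Cat.Hom.toFunctor h) arrow
  rw [ofIso_arrow, ofIso_arrow] at this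
  exact this.trans ((Category.id_comp _).trans (Category.comp_id _))

end Interval

/-! ### Objects of colimits of categories -/

/-- A property of objects holds everywhere if functors to indiscrete categories are determined
by their values on the objects which have it. -/
lemma forall_obj_of_indiscrete {W : Cat.{u, u}} (P : W → Prop)
    (h : ∀ F G : W ⟶ Cat.of (Indiscrete.{u} (ULift.{u} Prop)),
      (∀ w, P w → F.toFunctor.obj w = G.toFunctor.obj w) → F = G) (w : W) : P w := by
  -- The characteristic function of `P` and the constant `True` agree wherever `P` holds, so they
  -- are equal.
  have key := h (Indiscrete.functor fun w => ⟨P w⟩).toCatHom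
    (Indiscrete.functor fun _ => ⟨True⟩).toCatHom fun w hw => by
      simp [Indiscrete.functor, hw]
  have := congrArg (fun F => (F.toFunctor.obj w).as.down) key
  exact cast this.symm trivial

/-- Surjectivity on objects is stable under pushouts of categories. -/
lemma obj_surjective_of_isPushout {A B C W : Cat.{u, u}} {f : A ⟶ B} {g : A ⟶ C}
    {inl : B ⟶ W} {inr : C ⟶ W} (sq : IsPushout f g inl inr)
    (hg : Function.Surjective g.toFunctor.obj) : Function.Surjective inl.toFunctor.obj := by
  refine forall_obj_of_indiscrete (fun w => ∃ b, inl.toFunctor.obj b = w) fun F G h => ?_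
  refine sq.hom_ext (Cat.Hom.ext (Indiscrete.functor_ext fun b => h _ ⟨b, rfl⟩))
    (Cat.Hom.ext (Indiscrete.functor_ext fun c => h _ ?_))
  obtain ⟨a, rfl⟩ := hg c
  exact ⟨f.toFunctor.obj a, congrArg (fun F => F.toFunctor.obj a) sq.w⟩

lemma coprod_obj_cases {A B : Cat.{u, u}} (w : (A ⨿ B : Cat.{u, u})) :
    (∃ a, (coprod.inl : A ⟶ A ⨿ B).toFunctor.obj a = w) ∨
      ∃ b, (coprod.inr : B ⟶ A ⨿ B).toFunctor.obj b = w := by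
  revert w
  refine forall_obj_of_indiscrete _ fun F G h => ?_
  exact coprod.hom_ext (Cat.Hom.ext (Indiscrete.functor_ext fun b => h _ (.inl ⟨b, rfl⟩)))
    (Cat.Hom.ext (Indiscrete.functor_ext fun b => h _ (.inr ⟨b, rfl⟩)))

/-! ### The terminal category -/

/-- The terminal category is the discrete category on a point. -/
noncomputable def terminalIso : ⊤_ Cat.{u, u} ≅ Cat.of (Discrete PUnit.{u + 1}) :=
  Cat.terminalIsoOfUniqueOfIsDiscrete

/-- The object of the terminal category. -/
noncomputable def star : (⊤_ Cat.{u, u} : Cat.{u, u}) := terminalIso.inv.toFunctor.obj ⟨⟨⟩⟩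

lemma eq_star (x : (⊤_ Cat.{u, u} : Cat.{u, u})) : x = star := by
  have := congrArg (fun F => F.toFunctor.obj x) terminalIso.{u}.hom_inv_id
  exact this.symm

lemma terminal_hom_ext {T : Cat.{u, u}} {F G : ⊤_ Cat.{u, u} ⟶ T}
    (h : F.toFunctor.obj star = G.toFunctor.obj star) : F = G := by
  have ext {F G : Discrete PUnit.{u + 1} ⥤ T} (h : F.obj ⟨⟨⟩⟩ = G.obj ⟨⟨⟩⟩) : F = G := by
    refine CategoryTheory.Functor.ext (fun _ => h) ?_
    rintro ⟨⟨⟩⟩ ⟨⟨⟩⟩ f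
    obtain rfl : f = 𝟙 _ := Subsingleton.elim _ _
    simp
  rw [← cancel_epi terminalIso.inv]
  exact Cat.Hom.ext (ext h)

/-- The functor from the terminal category which picks an object. -/
noncomputable def point {T : Cat.{u, u}} (t : T) : ⊤_ Cat.{u, u} ⟶ T :=
  ((Functor.const _).obj t).toCatHom

/-! ### Groupoids -/

/-- An equivalence and its quasi-inverse both reflect isomorphisms. -/
lemma isGroupoid_iff_of_isEquivalence {A B : Cat.{u, u}} (F : A ⟶ B)
    (hF : F.toFunctor.IsEquivalence) : IsGroupoid A ↔ IsGroupoid B :=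
  ⟨fun _ => isGroupoid_of_reflects_iso F.toFunctor.inv,
    fun _ => isGroupoid_of_reflects_iso F.toFunctor⟩

lemma isEquivalence_of_isIso {A B : Cat.{u, u}} (F : A ⟶ B) [IsIso F] :
    F.toFunctor.IsEquivalence :=
  (Cat.equivOfIso (asIso F)).isEquivalence_functor

lemma isGroupoid_terminal : IsGroupoid (⊤_ Cat.{u, u} : Cat.{u, u}) :=
  (isGroupoid_iff_of_isEquivalence terminalIso.hom (isEquivalence_of_isIso _)).2
    (inferInstanceAs (IsGroupoid (Discrete PUnit)))

/-- The inclusion of the core of a category. -/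
def coreInclusion (T : Cat.{u, u}) : Cat.of (Core T) ⟶ T := (Core.inclusion T).toCatHom

/-- The factorization of a functor out of a groupoid through the core of its target. -/
noncomputable def toCore {A T : Cat.{u, u}} [IsGroupoid A] (F : A ⟶ T) : A ⟶ Cat.of (Core T) :=
  Functor.toCatHom
    { obj := fun a => ⟨F.toFunctor.obj a⟩
      map := fun f => ⟨asIso (F.toFunctor.map f)⟩
      map_id := fun a => by apply Core.hom_ext; simp
      map_comp := fun f g => by apply Core.hom_ext; simp }

lemma toCore_comp {A T : Cat.{u, u}} [IsGroupoid A] (F : A ⟶ T) :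
    toCore F ≫ coreInclusion T = F := rfl

lemma comp_toCore {A B T : Cat.{u, u}} [IsGroupoid A] [IsGroupoid B] (F : A ⟶ B) (G : B ⟶ T) :
    F ≫ toCore G = toCore (F ≫ G) := rfl

/-- Colimits of groupoids in categories are groupoids. -/
lemma isGroupoid_of_isColimit {J : Type*} [Category* J] {F : J ⥤ Cat.{u, u}} {c : Cocone F}
    (hc : IsColimit c) (h : ∀ j, IsGroupoid (F.obj j)) : IsGroupoid c.pt := by
  -- The colimit cocone lifts to the core of its apex, and the induced functor is a section of the
  -- inclusion of the core.
  let s : Cocone F :=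
    { pt := Cat.of (Core c.pt)
      ι :=
        { app := fun j => toCore (c.ι.app j)
          naturality := fun i j f => by
            rw [comp_toCore]
            simp } }
  have hs : hc.desc s ≫ coreInclusion c.pt = 𝟙 _ := hc.hom_ext fun j => by
    rw [hc.fac_assoc, Category.comp_id]
    exact toCore_comp _
  -- By `hs`, up to `eqToHom`s, `f` is the image of a morphism of the core, hence invertible.
  refine ⟨fun {x y} f => ?_⟩
  have hd : IsIso ((hc.desc s ≫ coreInclusion c.pt).toFunctor.map f) :=
    ((hc.desc s).toFunctor.map f).iso.isIso_hom
  have hf : IsIso ((𝟙 c.pt : c.pt ⟶ c.pt).toFunctor.map f) := by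
    rw [Functor.congr_hom (congrArg Cat.Hom.toFunctor hs.symm) f]
    infer_instance
  exact hf

lemma isGroupoid_of_isPushout {A B C W : Cat.{u, u}} {f : A ⟶ B} {g : A ⟶ C}
    {inl : B ⟶ W} {inr : C ⟶ W} (sq : IsPushout f g inl inr)
    (hA : IsGroupoid A) (hB : IsGroupoid B) (hC : IsGroupoid C) : IsGroupoid W :=
  isGroupoid_of_isColimit sq.isColimit (by rintro (_ | _ | _) <;> assumption)

lemma isGroupoid_sigma {I : Type u} {S : I → Cat.{u, u}} (h : ∀ i, IsGroupoid (S i)) :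
    IsGroupoid (∐ S : Cat.{u, u}) :=
  isGroupoid_of_isColimit (colimit.isColimit (Discrete.functor S)) fun ⟨i⟩ => h i

lemma isGroupoid_coprod {A B : Cat.{u, u}} (hA : IsGroupoid A) (hB : IsGroupoid B) :
    IsGroupoid (A ⨿ B : Cat.{u, u}) :=
  isGroupoid_of_isColimit (colimit.isColimit (pair A B)) (by rintro ⟨_ | _⟩ <;> assumption)

/-- Spheres are groupoids. -/
lemma IsSphere.isGroupoid {n : ℕ} {X : Cat.{u, u}} (h : IsSphere n X) : IsGroupoid X := by
  cases n with
  | zero =>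
    obtain ⟨e⟩ := h
    exact (isGroupoid_iff_of_isEquivalence e.hom (isEquivalence_of_isIso _)).2
      (isGroupoid_coprod isGroupoid_terminal isGroupoid_terminal)
  | succ n =>
    obtain ⟨S, hS, A, B, C, f, g, inl, inr, p, q, r, -, -, -, hp, hq, hr, -, -, sq⟩ := h
    exact isGroupoid_of_isPushout sq
      ((isGroupoid_iff_of_isEquivalence p hp.2).2 hS.isGroupoid)
      ((isGroupoid_iff_of_isEquivalence r hr.2).2 isGroupoid_terminal)
      ((isGroupoid_iff_of_isEquivalence q hq.2).2 isGroupoid_terminal)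

/-- CW-complexes are groupoids. -/
lemma IsCWComplex.isGroupoid {n : ℕ} {X : Cat.{u, u}} (h : IsCWComplex n X) : IsGroupoid X := by
  induction n generalizing X with
  | zero =>
    obtain ⟨-, I, ⟨e⟩⟩ := h
    exact (isGroupoid_iff_of_isEquivalence e.hom (isEquivalence_of_isIso _)).2
      (isGroupoid_sigma fun _ => isGroupoid_terminal)
  | succ n ih =>
    obtain ⟨I, S, Y, f, hS, hY, -, Y', g, p, inl, inr, -, hp, -, sq⟩ := h
    exact isGroupoid_of_isPushout sq (isGroupoid_sigma fun i => (hS i).isGroupoid) (ih hY)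
      ((isGroupoid_iff_of_isEquivalence p hp.2).2 (isGroupoid_sigma fun _ => isGroupoid_terminal))

lemma WeaklyEquivalent.isGroupoid_iff {X Z : Cat.{u, u}} (h : WeaklyEquivalent X Z) :
    IsGroupoid X ↔ IsGroupoid Z := by
  induction h with
  | rel A B h =>
    obtain ⟨F, hF⟩ := h
    exact isGroupoid_iff_of_isEquivalence F hF.mem
  | refl => rfl
  | symm _ _ _ ih => exact ih.symm
  | trans _ _ _ _ _ ih₁ ih₂ => exact ih₁.trans ih₂

/-! ### Coproducts of categories -/

/-- The explicit disjoint union of a family of categories. -/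
abbrev sigmaCat {I : Type u} (S : I → Cat.{u, u}) : Cat.{u, u} := Cat.of (Σ i, S i)

/-- The cofan of inclusions into the disjoint union. -/
abbrev sigmaCofan {I : Type u} (S : I → Cat.{u, u}) : Cofan S :=
  Cofan.mk (sigmaCat S) fun i => (Sigma.incl (C := fun i => S i) i).toCatHom

/-- The disjoint union is the coproduct in the category of categories. -/
def sigmaCofanIsColimit {I : Type u} (S : I → Cat.{u, u}) : IsColimit (sigmaCofan S) :=
  Cofan.IsColimit.mk _ (fun s => (Sigma.desc fun i => (s.inj i).toFunctor).toCatHom)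
    (fun _ _ => rfl)
    (fun s m h => by
      refine Cat.Hom.ext (CategoryTheory.Functor.ext ?_ ?_)
      · rintro ⟨i, x⟩
        exact congrArg (fun F => F.toFunctor.obj x) (h i)
      · rintro ⟨i, x⟩ ⟨_, y⟩ ⟨f⟩
        exact Functor.congr_hom (congrArg Cat.Hom.toFunctor (h i)) f)

/-- The comparison of the chosen coproduct with the disjoint union. -/
noncomputable def sigmaIso {I : Type u} (S : I → Cat.{u, u}) : ∐ S ≅ sigmaCat S :=
  (coproductIsCoproduct S).coconePointUniqueUpToIso (sigmaCofanIsColimit S)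

lemma ι_sigmaIso_hom {I : Type u} (S : I → Cat.{u, u}) (i : I) :
    Limits.Sigma.ι S i ≫ (sigmaIso S).hom = (sigmaCofan S).inj i :=
  (coproductIsCoproduct S).comp_coconePointUniqueUpToIso_hom (sigmaCofanIsColimit S) ⟨i⟩

/-- The disjoint union of a family of functors. -/
abbrev sigmaFunctor {I : Type u} {S T : I → Cat.{u, u}} (F : ∀ i, S i ⟶ T i) :
    sigmaCat S ⟶ sigmaCat T :=
  (Sigma.Functor.sigma fun i => (F i).toFunctor).toCatHom

/-- Carries questions about maps of chosen coproducts over to the disjoint union, whose objects and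
morphisms are explicit. -/
lemma sigma_map_eq {I : Type u} {S T : I → Cat.{u, u}} (F : ∀ i, S i ⟶ T i) :
    Limits.Sigma.map F = (sigmaIso S).hom ≫ sigmaFunctor F ≫ (sigmaIso T).inv := by
  rw [← Category.assoc, Iso.eq_comp_inv]
  refine Limits.Sigma.hom_ext _ _ fun i => ?_
  rw [← Category.assoc, Limits.Sigma.ι_map, Category.assoc, ι_sigmaIso_hom, ← Category.assoc,
    ι_sigmaIso_hom]
  rfl

lemma obj_bijective_of_isIso {A B : Cat.{u, u}} (F : A ⟶ B) [IsIso F] :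
    Function.Bijective F.toFunctor.obj := by
  refine Function.bijective_iff_has_inverse.2 ⟨(inv F).toFunctor.obj, fun x => ?_, fun x => ?_⟩
  · exact congrArg (fun F => F.toFunctor.obj x) (IsIso.hom_inv_id F)
  · exact congrArg (fun F => F.toFunctor.obj x) (IsIso.inv_hom_id F)

section Sigma

variable {I : Type u} {S T : I → Cat.{u, u}} (F : ∀ i, S i ⟶ T i)

lemma sigma_map_obj_injective (h : ∀ i, Function.Injective (F i).toFunctor.obj) :
    Function.Injective (Limits.Sigma.map F).toFunctor.obj := by
  rw [sigma_map_eq]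
  refine ((obj_bijective_of_isIso (sigmaIso T).inv).1.comp ?_).comp
    (obj_bijective_of_isIso (sigmaIso S).hom).1
  exact Function.Injective.sigma_map (β₁ := fun i => S i) (β₂ := fun i => T i) (f₁ := id)
    (f₂ := fun i => (F i).toFunctor.obj)
    Function.injective_id h

lemma sigma_map_obj_surjective (h : ∀ i, Function.Surjective (F i).toFunctor.obj) :
    Function.Surjective (Limits.Sigma.map F).toFunctor.obj := by
  rw [sigma_map_eq]
  refine ((obj_bijective_of_isIso (sigmaIso T).inv).2.comp ?_).comp
    (obj_bijective_of_isIso (sigmaIso S).hom).2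
  exact Function.Surjective.sigma_map (β₁ := fun i => S i) (β₂ := fun i => T i) (f₁ := id)
    (f₂ := fun i => (F i).toFunctor.obj)
    Function.surjective_id h

lemma sigma_map_isEquivalence (h : ∀ i, (F i).toFunctor.IsEquivalence) :
    (Limits.Sigma.map F).toFunctor.IsEquivalence := by
  rw [sigma_map_eq]
  have h₁ := isEquivalence_of_isIso (sigmaIso S).hom
  have h₂ := isEquivalence_of_isIso (sigmaIso T).inv
  have h₃ : (sigmaFunctor F).toFunctor.IsEquivalence :=
    { faithful := ⟨by
        rintro ⟨i, x⟩ ⟨_, y⟩ ⟨f⟩ ⟨g⟩ hfg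
        exact congrArg Sigma.SigmaHom.mk
          ((F i).toFunctor.map_injective ((Sigma.incl i).map_injective hfg))⟩
      full := ⟨by
        rintro ⟨i, x⟩ ⟨j, y⟩ f
        obtain ⟨f⟩ : Sigma.SigmaHom (C := fun i => T i) ⟨i, (F i).toFunctor.obj x⟩
          ⟨j, (F j).toFunctor.obj y⟩ := f
        obtain ⟨g, rfl⟩ := (F i).toFunctor.map_surjective f
        exact ⟨Sigma.SigmaHom.mk g, rfl⟩⟩
      essSurj := ⟨by
        rintro ⟨i, y⟩
        exact ⟨⟨i, (F i).toFunctor.objPreimage y⟩,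
          ⟨(Sigma.incl i).mapIso ((F i).toFunctor.objObjPreimageIso y)⟩⟩⟩ }
  exact inferInstanceAs ((sigmaIso S).hom.toFunctor ⋙ (sigmaFunctor F).toFunctor ⋙
    (sigmaIso T).inv.toFunctor).IsEquivalence

end Sigma

/-! ### Cofibrant objects and acyclic fibrations -/

/-- The initial category maps to the empty one, so it has no objects and injectivity is vacuous. -/
lemma isCofibrant (X : Cat.{u, u}) : IsCofibrant X := by
  have e : ⊥_ Cat.{u, u} ⟶ Cat.of (Discrete PEmpty.{u + 1}) := initial.to _
  exact ⟨fun x => (e.toFunctor.obj x).as.elim⟩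

/-- A functor into the source of a fully faithful functor `p`, from a lift on objects
of a functor into the target of `p`. -/
noncomputable def liftOfObj {B E D : Cat.{u, u}} (p : E ⟶ D) [p.toFunctor.Full]
    [p.toFunctor.Faithful] (b : B ⟶ D) (φ : B → E)
    (h : ∀ x, p.toFunctor.obj (φ x) = b.toFunctor.obj x) : B ⟶ E :=
  Functor.toCatHom
    { obj := φ
      map := fun {x y} f => p.toFunctor.preimage
        (eqToHom (h x) ≫ b.toFunctor.map f ≫ eqToHom (h y).symm)
      map_id := fun x => p.toFunctor.map_injective (by simp)
      map_comp := fun f g => p.toFunctor.map_injective (by simp) }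

lemma liftOfObj_comp {B E D : Cat.{u, u}} (p : E ⟶ D) [p.toFunctor.Full]
    [p.toFunctor.Faithful] (b : B ⟶ D) (φ : B → E)
    (h : ∀ x, p.toFunctor.obj (φ x) = b.toFunctor.obj x) : liftOfObj p b φ h ≫ p = b :=
  Cat.Hom.ext (CategoryTheory.Functor.ext h fun _ _ _ => p.toFunctor.map_preimage _)

/-- A faithful functor is cancellable for functors which agree on objects. -/
lemma eq_of_comp_faithful {A E D : Cat.{u, u}} (p : E ⟶ D) [p.toFunctor.Faithful]
    {F G : A ⟶ E} (hobj : ∀ x, F.toFunctor.obj x = G.toFunctor.obj x) (h : F ≫ p = G ≫ p) :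
    F = G := by
  refine Cat.Hom.ext (CategoryTheory.Functor.ext hobj fun x y f => p.toFunctor.map_injective ?_)
  have := Functor.congr_hom (congrArg Cat.Hom.toFunctor h) f
  simpa [eqToHom_map] using this

/-- Equivalences which are surjective on objects lift against cofibrations. -/
lemma hasLiftingProperty_of_surjective {A B E D : Cat.{u, u}} (i : A ⟶ B) (p : E ⟶ D)
    (hi : Function.Injective i.toFunctor.obj) (hp : p.toFunctor.IsEquivalence)
    (hs : Function.Surjective p.toFunctor.obj) : HasLiftingProperty i p := by
  refine ⟨fun {a b} sq => ?_⟩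
  -- On the image of `i` the lift is forced by `a`, consistently because `i` is injective; elsewhere
  -- any preimage under `p` will do. Full faithfulness then determines the lift on morphisms.
  have hobj : ∀ x : B, ∃ e : E, p.toFunctor.obj e = b.toFunctor.obj x ∧
      ∀ y : A, i.toFunctor.obj y = x → e = a.toFunctor.obj y := by
    intro x
    by_cases hx : ∃ y, i.toFunctor.obj y = x
    · obtain ⟨y, rfl⟩ := hx
      refine ⟨a.toFunctor.obj y, congrArg (fun F => F.toFunctor.obj y) sq.w, fun z hz => ?_⟩
      rw [hi hz]
    · obtain ⟨e, he⟩ := hs (b.toFunctor.obj x)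
      exact ⟨e, he, fun y hy => (hx ⟨y, hy⟩).elim⟩
  choose φ h₁ h₂ using hobj
  refine ⟨⟨⟨liftOfObj p b φ h₁, ?_, liftOfObj_comp p b φ h₁⟩⟩⟩
  refine eq_of_comp_faithful p (fun x => h₂ _ x rfl) ?_
  rw [Category.assoc, liftOfObj_comp, sq.w]

lemma trivialFibrations_of_surjective {E D : Cat.{u, u}} (p : E ⟶ D)
    (hp : p.toFunctor.IsEquivalence) (hs : Function.Surjective p.toFunctor.obj) :
    trivialFibrations Cat.{u, u} p :=
  ⟨fun _ _ i hi => hasLiftingProperty_of_surjective i p hi.1 hp hs, hp⟩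

/-! ### The interval, the circle and the attachment of cells -/

namespace Interval

lemma terminal_from_isEquivalence : (terminal.from Interval.{u}).toFunctor.IsEquivalence where
  faithful := ⟨fun _ => rfl⟩
  full := ⟨fun {x y} f => ⟨PUnit.unit, by
    -- Parallel morphisms of the terminal category agree, as they do in the discrete category on a
    -- point.
    have h : ∀ {a b : (⊤_ Cat.{u, u} : Cat.{u, u})} (f g : a ⟶ b), f = g := fun f g => by
      have := (isEquivalence_of_isIso terminalIso.{u}.hom).faithful
      exact terminalIso.hom.toFunctor.map_injective
        (Subsingleton.elim (α := (_ : Discrete _) ⟶ _) _ _)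
    exact h _ _⟩⟩
  essSurj := ⟨fun y => ⟨src, ⟨eqToIso ((eq_star _).trans (eq_star y).symm)⟩⟩⟩

lemma terminal_from_surjective :
    Function.Surjective (terminal.from Interval.{u}).toFunctor.obj :=
  fun y => ⟨src, (eq_star _).trans (eq_star y).symm⟩

/-- The inclusion of the two ends of the interval. -/
noncomputable def endpoints : (⊤_ Cat.{u, u}) ⨿ (⊤_ Cat.{u, u}) ⟶ Interval.{u} :=
  coprod.desc (point src) (point tgt)

lemma endpoints_inl (x : (⊤_ Cat.{u, u} : Cat.{u, u})) : endpoints.toFunctor.obj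
    ((coprod.inl : _ ⟶ (⊤_ Cat.{u, u}) ⨿ (⊤_ Cat.{u, u})).toFunctor.obj x) = src :=
  congrArg (fun F => F.toFunctor.obj x) (coprod.inl_desc (point src) (point tgt))

lemma endpoints_inr (x : (⊤_ Cat.{u, u} : Cat.{u, u})) : endpoints.toFunctor.obj
    ((coprod.inr : _ ⟶ (⊤_ Cat.{u, u}) ⨿ (⊤_ Cat.{u, u})).toFunctor.obj x) = tgt :=
  congrArg (fun F => F.toFunctor.obj x) (coprod.inr_desc (point src) (point tgt))

lemma src_ne_tgt : src.{u} ≠ tgt := fun h =>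
  Bool.false_ne_true (congrArg (fun x : Indiscrete (ULift.{u} Bool) => x.as.down) h)

lemma endpoints_injective : Function.Injective endpoints.{u}.toFunctor.obj := by
  intro x y h
  obtain ⟨a, rfl⟩ | ⟨a, rfl⟩ := coprod_obj_cases x <;>
    obtain ⟨b, rfl⟩ | ⟨b, rfl⟩ := coprod_obj_cases y
  · rw [eq_star a, eq_star b]
  · rw [endpoints_inl, endpoints_inr] at h
    exact (src_ne_tgt h).elim
  · rw [endpoints_inl, endpoints_inr] at h
    exact (src_ne_tgt h.symm).elim
  · rw [eq_star a, eq_star b]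

lemma endpoints_surjective : Function.Surjective endpoints.{u}.toFunctor.obj := by
  rintro ⟨⟨_ | _⟩⟩
  · exact ⟨_, endpoints_inl star⟩
  · exact ⟨_, endpoints_inr star⟩

end Interval

/-- The circle: two isomorphisms glued at their ends. -/
noncomputable def circle : Cat.{u, u} := pushout Interval.endpoints Interval.endpoints

namespace circle

/-- The first arc of the circle. -/
noncomputable def arc₁ : Interval.{u} ⟶ circle := pushout.inl _ _

/-- The second arc of the circle. -/
noncomputable def arc₂ : Interval.{u} ⟶ circle := pushout.inr _ _

lemma isPushout : IsPushout Interval.endpoints.{u} Interval.endpoints arc₁ arc₂ :=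
  IsPushout.of_hasPushout _ _

/-- The 0-sphere is kept as it is, and each copy of `1` is replaced by the interval, into which the
0-sphere embeds as the two ends. -/
lemma isSphere : IsSphere 1 circle.{u} := by
  have hI := trivialFibrations_of_surjective _ Interval.terminal_from_isEquivalence.{u}
    Interval.terminal_from_surjective
  exact ⟨_, ⟨Iso.refl _⟩, _, _, _, _, _, _, _, 𝟙 _, _, _, isCofibrant _,
    ⟨Interval.endpoints_injective⟩, ⟨Interval.endpoints_injective⟩,
    trivialFibrations_of_surjective _ (isEquivalence_of_isIso _) (obj_bijective_of_isIso _).2,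
    hI, hI, terminal.hom_ext _ _, terminal.hom_ext _ _, isPushout⟩

/-- The projection of the circle to the interval, folding the two arcs. -/
noncomputable def fold : circle.{u} ⟶ Interval := isPushout.desc (𝟙 _) (𝟙 _) rfl

lemma arc₁_fold : arc₁.{u} ≫ fold = 𝟙 _ := isPushout.inl_desc _ _ _

lemma arc₂_fold : arc₂.{u} ≫ fold = 𝟙 _ := isPushout.inr_desc _ _ _

/-- `arc₁` is a section of `fold` and already reaches every object of the circle, since both arcs
share their ends. -/
lemma fold_injective : Function.Injective fold.{u}.toFunctor.obj :=
  have hs : Function.Surjective arc₁.{u}.toFunctor.obj :=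
    obj_surjective_of_isPushout isPushout Interval.endpoints_surjective
  Function.LeftInverse.injective (g := arc₁.toFunctor.obj)
    (Function.RightInverse.leftInverse_of_surjective
      (fun x => congrArg (fun F => F.toFunctor.obj x) arc₁_fold) hs)

end circle

/-- Attaching cells along a family of spheres, each embedded on objects in an interval. -/
lemma isCWComplex_of_isPushout {n : ℕ} {I : Type u} {S Y W : Cat.{u, u}} {g : S ⟶ Interval}
    (hS : IsSphere n S) (hg : Function.Injective g.toFunctor.obj) (hY : IsCWComplex n Y)
    {f : (∐ fun _ : I => S) ⟶ Y} {inl : Y ⟶ W} {inr : (∐ fun _ : I => Interval) ⟶ W}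
    (sq : IsPushout f (Limits.Sigma.map fun _ : I => g) inl inr) : IsCWComplex (n + 1) W :=
  ⟨I, fun _ => S, Y, f, fun _ => hS, hY, isCofibrant _, _, _,
    Limits.Sigma.map fun _ => terminal.from _, inl, inr, ⟨sigma_map_obj_injective _ fun _ => hg⟩,
    trivialFibrations_of_surjective _
      (sigma_map_isEquivalence _ fun _ => Interval.terminal_from_isEquivalence)
      (sigma_map_obj_surjective _ fun _ => Interval.terminal_from_surjective),
    by
      refine Limits.Sigma.hom_ext _ _ fun i => ?_
      rw [Limits.Sigma.ι_map_assoc, Limits.Sigma.ι_map, Limits.Sigma.ι_map, ← Category.assoc]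
      congr 1
      exact terminal.hom_ext _ _, sq⟩

/-! ### Quotient functors -/

section Quotient

variable {Y X T : Cat.{u, u}} {q : Y ⟶ X}

/-- A full functor which is surjective on objects is an epimorphism. -/
lemma epi_of_full (hq : Function.Surjective q.toFunctor.obj) (hf : q.toFunctor.Full) : Epi q where
  left_cancellation {T} d d' h := by
    have hobj : ∀ x, d.toFunctor.obj x = d'.toFunctor.obj x := fun x => by
      obtain ⟨y, rfl⟩ := hq x
      exact congrArg (fun F => F.toFunctor.obj y) h
    refine Cat.Hom.ext (CategoryTheory.Functor.ext hobj fun x x' m => ?_)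
    obtain ⟨y, rfl⟩ := hq x
    obtain ⟨y', rfl⟩ := hq x'
    obtain ⟨p, rfl⟩ := q.toFunctor.map_surjective m
    exact Functor.congr_hom (congrArg Cat.Hom.toFunctor h) p

/-- A functor factors through a full functor `q`, bijective on objects, if it identifies
the parallel morphisms which `q` identifies. -/
lemma exists_factor_of_full (hq : Function.Bijective q.toFunctor.obj) (hf : q.toFunctor.Full)
    (H : Y ⟶ T) (hH : ∀ {a b : Y} (p p' : a ⟶ b), q.toFunctor.map p = q.toFunctor.map p' →
      H.toFunctor.map p = H.toFunctor.map p') : ∃ d : X ⟶ T, q ≫ d = H := by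
  obtain ⟨e, he, he'⟩ := Function.bijective_iff_has_inverse.1 hq
  -- An arbitrary preimage under `q`; by `hH` its image under `H` does not depend on the choice,
  -- which gives functoriality.
  let lift {x y : X} (m : x ⟶ y) : e x ⟶ e y :=
    q.toFunctor.preimage (eqToHom (he' x) ≫ m ≫ eqToHom (he' y).symm)
  have map_lift {x y : X} (m : x ⟶ y) :
      q.toFunctor.map (lift m) = eqToHom (he' x) ≫ m ≫ eqToHom (he' y).symm :=
    q.toFunctor.map_preimage _
  let d : X ⥤ T :=
    { obj := fun x => H.toFunctor.obj (e x)
      map := fun m => H.toFunctor.map (lift m)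
      map_id := fun x => by
        rw [← CategoryTheory.Functor.map_id]
        exact hH _ _ (by simp [map_lift])
      map_comp := fun m m' => by
        rw [← CategoryTheory.Functor.map_comp]
        exact hH _ _ (by simp [map_lift]) }
  refine ⟨d.toCatHom, Cat.Hom.ext (CategoryTheory.Functor.ext
    (fun y => congrArg H.toFunctor.obj (he y)) fun y y' p => ?_)⟩
  change H.toFunctor.map (lift (q.toFunctor.map p)) = _
  rw [hH _ (eqToHom (he y) ≫ p ≫ eqToHom (he y').symm) (by simp [map_lift, eqToHom_map])]
  simp [eqToHom_map]

end Quotient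

/-! ### Groupoids are obtained by attaching cells -/

section Presentation

variable (X : Cat.{u, u})

/-- The morphisms of a category. -/
abbrev Arrows : Type u := Σ a b : X, (a ⟶ b)

/-- The objects of a category, as a discrete category. -/
noncomputable abbrev vertices : Cat.{u, u} := ∐ fun _ : X => ⊤_ Cat.{u, u}

lemma isCWComplex_vertices : IsCWComplex 0 (vertices X) :=
  ⟨isCofibrant _, X, ⟨Iso.refl _⟩⟩

/-- The ends of the morphisms of a category. -/
noncomputable def attachEdges :
    (∐ fun _ : Arrows X => (⊤_ Cat.{u, u}) ⨿ (⊤_ Cat.{u, u})) ⟶ vertices X :=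
  Limits.Sigma.desc fun i => coprod.desc
    (Limits.Sigma.ι (fun _ : X => ⊤_ Cat.{u, u}) i.1)
    (Limits.Sigma.ι (fun _ : X => ⊤_ Cat.{u, u}) i.2.1)

/-- The groupoid freely generated by the morphisms of a category. -/
noncomputable def skeleton : Cat.{u, u} :=
  pushout (attachEdges X) (Limits.Sigma.map fun _ => Interval.endpoints)

/-- The inclusion of the vertices in the skeleton. -/
noncomputable def skeletonInl : vertices X ⟶ skeleton X := pushout.inl _ _

/-- The inclusion of the edges in the skeleton. -/
noncomputable def skeletonInr : (∐ fun _ : Arrows X => Interval) ⟶ skeleton X := pushout.inr _ _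

lemma skeleton_isPushout : IsPushout (attachEdges X)
    (Limits.Sigma.map fun _ => Interval.endpoints) (skeletonInl X) (skeletonInr X) :=
  IsPushout.of_hasPushout _ _

lemma isCWComplex_skeleton : IsCWComplex 1 (skeleton X) :=
  isCWComplex_of_isPushout (n := 0) ⟨Iso.refl _⟩ Interval.endpoints_injective
    (isCWComplex_vertices X) (skeleton_isPushout X)

/-- An interval has no objects besides its ends, so attaching edges creates no new objects. -/
lemma skeletonInl_surjective : Function.Surjective (skeletonInl X).toFunctor.obj :=
  obj_surjective_of_isPushout (skeleton_isPushout X)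
    (sigma_map_obj_surjective _ fun _ => Interval.endpoints_surjective)

/-- The functor from the discrete category of objects. -/
noncomputable def verticesMap : vertices X ⟶ X := Limits.Sigma.desc fun x => point x

lemma verticesMap_ι (x : X) (y : (⊤_ Cat.{u, u} : Cat.{u, u})) :
    (verticesMap X).toFunctor.obj
      ((Limits.Sigma.ι (fun _ : X => ⊤_ Cat.{u, u}) x).toFunctor.obj y) = x :=
  congrArg (fun F => F.toFunctor.obj y) (Limits.Sigma.ι_desc (fun x : X => point x) x)

lemma vertices_obj_cases (v : vertices X) :
    ∃ x : X, (Limits.Sigma.ι (fun _ : X => ⊤_ Cat.{u, u}) x).toFunctor.obj star = v := by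
  revert v
  refine forall_obj_of_indiscrete _ fun F G h => ?_
  exact Limits.Sigma.hom_ext _ _ fun x => terminal_hom_ext (h _ ⟨x, rfl⟩)

lemma verticesMap_bijective : Function.Bijective (verticesMap X).toFunctor.obj := by
  refine ⟨fun v w h => ?_, fun x => ⟨_, verticesMap_ι X x star⟩⟩
  obtain ⟨x, rfl⟩ := vertices_obj_cases X v
  obtain ⟨y, rfl⟩ := vertices_obj_cases X w
  rw [verticesMap_ι, verticesMap_ι] at h
  rw [h]

variable [IsGroupoid X]

/-- The functor from the disjoint union of the morphisms of a groupoid. -/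
noncomputable def edgesMap : (∐ fun _ : Arrows X => Interval) ⟶ X :=
  Limits.Sigma.desc fun i => Interval.ofIso (asIso i.2.2)

lemma attachEdges_verticesMap : attachEdges X ≫ verticesMap X =
    (Limits.Sigma.map fun _ => Interval.endpoints) ≫ edgesMap X := by
  refine Limits.Sigma.hom_ext _ _ fun i => ?_
  rw [attachEdges, Limits.Sigma.ι_desc_assoc, Limits.Sigma.ι_map_assoc, edgesMap,
    Limits.Sigma.ι_desc]
  apply coprod.hom_ext
  · rw [coprod.inl_desc_assoc, Interval.endpoints, coprod.inl_desc_assoc]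
    exact terminal_hom_ext (verticesMap_ι X i.1 star)
  · rw [coprod.inr_desc_assoc, Interval.endpoints, coprod.inr_desc_assoc]
    exact terminal_hom_ext (verticesMap_ι X i.2.1 star)

/-- The evaluation functor from the free groupoid on the morphisms of a groupoid. -/
noncomputable def skeletonMap : skeleton X ⟶ X :=
  (skeleton_isPushout X).desc (verticesMap X) (edgesMap X) (attachEdges_verticesMap X)

lemma skeletonInl_map : skeletonInl X ≫ skeletonMap X = verticesMap X :=
  (skeleton_isPushout X).inl_desc _ _ _

lemma skeletonInr_map : skeletonInr X ≫ skeletonMap X = edgesMap X :=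
  (skeleton_isPushout X).inr_desc _ _ _

/-- Its composite with `skeletonInl`, which is surjective on objects, is `verticesMap`, which is
bijective on objects. -/
lemma skeletonMap_bijective : Function.Bijective (skeletonMap X).toFunctor.obj := by
  have h : (skeletonMap X).toFunctor.obj ∘ (skeletonInl X).toFunctor.obj =
      (verticesMap X).toFunctor.obj :=
    congrArg (fun F => F.toFunctor.obj) (skeletonInl_map X)
  have hb := verticesMap_bijective X
  rw [← h] at hb
  exact ⟨hb.1.of_comp_right (skeletonInl_surjective X), hb.2.of_comp⟩

/-- The edge of the skeleton given by a morphism. -/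
noncomputable def edge (i : Arrows X) : Interval ⟶ skeleton X :=
  Limits.Sigma.ι (fun _ : Arrows X => Interval) i ≫ skeletonInr X

lemma edge_map (i : Arrows X) : edge X i ≫ skeletonMap X = Interval.ofIso (asIso i.2.2) := by
  rw [edge, Category.assoc, skeletonInr_map, edgesMap, Limits.Sigma.ι_desc]

/-- Every morphism of `X` is the value of its own edge. Injectivity on objects identifies the ends
of that edge with the prescribed objects. -/
lemma skeletonMap_full : (skeletonMap X).toFunctor.Full where
  map_surjective {y y'} m := by
    have h := edge_map X ⟨_, _, m⟩
    have hs : (edge X ⟨_, _, m⟩).toFunctor.obj Interval.src = y :=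
      (skeletonMap_bijective X).1 (congrArg (fun F => F.toFunctor.obj Interval.src) h)
    have ht : (edge X ⟨_, _, m⟩).toFunctor.obj Interval.tgt = y' :=
      (skeletonMap_bijective X).1 (congrArg (fun F => F.toFunctor.obj Interval.tgt) h)
    have ha := Functor.congr_hom (congrArg Cat.Hom.toFunctor h) Interval.arrow
    rw [Interval.ofIso_arrow] at ha
    replace ha : (skeletonMap X).toFunctor.map
        ((edge X ⟨_, _, m⟩).toFunctor.map Interval.arrow) =
      eqToHom (congrArg (skeletonMap X).toFunctor.obj hs) ≫ m ≫
        eqToHom (congrArg (skeletonMap X).toFunctor.obj ht).symm := ha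
    refine ⟨eqToHom hs.symm ≫ (edge X ⟨_, _, m⟩).toFunctor.map Interval.arrow ≫ eqToHom ht, ?_⟩
    rw [Functor.map_comp, Functor.map_comp, eqToHom_map, eqToHom_map, ha]
    simp

/-- The pairs of parallel morphisms of the skeleton with the same value. -/
abbrev Relations : Type u :=
  Σ (a b : skeleton X) (p : a ⟶ b),
    { p' : a ⟶ b // (skeletonMap X).toFunctor.map p = (skeletonMap X).toFunctor.map p' }

instance : IsGroupoid (skeleton X) := (isCWComplex_skeleton X).isGroupoid

lemma circle_loop_w {T : Cat.{u, u}} {a b : T} (e e' : a ≅ b) :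
    Interval.endpoints ≫ Interval.ofIso e = Interval.endpoints ≫ Interval.ofIso e' := by
  apply coprod.hom_ext
  · rw [Interval.endpoints, coprod.inl_desc_assoc, coprod.inl_desc_assoc]
    exact terminal_hom_ext rfl
  · rw [Interval.endpoints, coprod.inr_desc_assoc, coprod.inr_desc_assoc]
    exact terminal_hom_ext rfl

/-- The functor out of the circle classifying two parallel isomorphisms. -/
noncomputable def circle.ofIsos {T : Cat.{u, u}} {a b : T} (e e' : a ≅ b) : circle ⟶ T :=
  circle.isPushout.desc (Interval.ofIso e) (Interval.ofIso e') (circle_loop_w e e')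

lemma circle.arc₁_ofIsos {T : Cat.{u, u}} {a b : T} (e e' : a ≅ b) :
    circle.arc₁ ≫ circle.ofIsos e e' = Interval.ofIso e :=
  circle.isPushout.inl_desc _ _ _

lemma circle.arc₂_ofIsos {T : Cat.{u, u}} {a b : T} (e e' : a ≅ b) :
    circle.arc₂ ≫ circle.ofIsos e e' = Interval.ofIso e' :=
  circle.isPushout.inr_desc _ _ _

/-- The attaching map of the relations. -/
noncomputable def attachRelations : (∐ fun _ : Relations X => circle) ⟶ skeleton X :=
  Limits.Sigma.desc fun r => circle.ofIsos (asIso r.2.2.1) (asIso r.2.2.2.1)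

/-- The common values of the relations. -/
noncomputable def relationsMap : (∐ fun _ : Relations X => Interval) ⟶ X :=
  Limits.Sigma.desc fun r => Interval.ofIso (asIso r.2.2.1) ≫ skeletonMap X

lemma presentation_w : attachRelations X ≫ skeletonMap X =
    (Limits.Sigma.map fun _ => circle.fold) ≫ relationsMap X := by
  refine Limits.Sigma.hom_ext _ _ fun r => ?_
  rw [attachRelations, relationsMap, Limits.Sigma.ι_desc_assoc, Limits.Sigma.ι_map_assoc,
    Limits.Sigma.ι_desc]
  apply circle.isPushout.hom_ext
  -- The equation is checked on each arc: the first is immediate, the second is the defining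
  -- equality of the relation `r`.
  · rw [← Category.assoc, circle.arc₁_ofIsos, ← Category.assoc, circle.arc₁_fold,
      Category.id_comp]
  · rw [← Category.assoc, circle.arc₂_ofIsos, ← Category.assoc, circle.arc₂_fold,
      Category.id_comp, Interval.ofIso_comp, Interval.ofIso_comp]
    congr 1
    exact Iso.ext r.2.2.2.2.symm

/-- The first arcs form a section. Through this cancellation, a functor out of `X` that is
compatible with a cocone on the skeleton is automatically compatible on the 2-cells. -/
lemma epi_sigma_map_fold (I : Type u) :
    Epi (Limits.Sigma.map fun _ : I => circle.fold.{u}) := by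
  have h : (Limits.Sigma.map fun _ : I => circle.arc₁.{u}) ≫
      (Limits.Sigma.map fun _ : I => circle.fold.{u}) = 𝟙 _ := by
    refine Limits.Sigma.hom_ext _ _ fun i => ?_
    rw [Limits.Sigma.ι_map_assoc, Limits.Sigma.ι_map, ← Category.assoc, circle.arc₁_fold,
      Category.id_comp, Category.comp_id]
  exact (SplitEpi.mk _ h).epi

/-- Functors compatible with the relations identify related morphisms. -/
lemma map_eq_of_relations {T : Cat.{u, u}} {H : skeleton X ⟶ T}
    {K : (∐ fun _ : Relations X => Interval) ⟶ T}
    (w : attachRelations X ≫ H = (Limits.Sigma.map fun _ => circle.fold) ≫ K)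
    {a b : skeleton X} (p p' : a ⟶ b)
    (h : (skeletonMap X).toFunctor.map p = (skeletonMap X).toFunctor.map p') :
    H.toFunctor.map p = H.toFunctor.map p' := by
  let r : Relations X := ⟨a, b, p, p', h⟩
  have wr : circle.ofIsos (asIso p) (asIso p') ≫ H =
      circle.fold ≫ Limits.Sigma.ι (fun _ : Relations X => Interval) r ≫ K := by
    have := Limits.Sigma.ι (fun _ : Relations X => circle) r ≫= w
    rwa [attachRelations, Limits.Sigma.ι_desc_assoc, Limits.Sigma.ι_map_assoc] at this
  have h₁ := circle.arc₁ ≫= wr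
  have h₂ := circle.arc₂ ≫= wr
  rw [← Category.assoc, circle.arc₁_ofIsos, ← Category.assoc, circle.arc₁_fold] at h₁
  rw [← Category.assoc, circle.arc₂_ofIsos, ← Category.assoc, circle.arc₂_fold] at h₂
  exact Interval.map_eq_of_ofIso_comp_eq (h₁.trans h₂.symm)

/-- A groupoid is the quotient of its skeleton by the relations. -/
lemma presentation_isPushout : IsPushout (attachRelations X)
    (Limits.Sigma.map fun _ => circle.fold) (skeletonMap X) (relationsMap X) := by
  have := epi_of_full (skeletonMap_bijective X).2 (skeletonMap_full X)
  have := epi_sigma_map_fold (Relations X)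
  -- The cocone condition says that `s.inl` equates the two members of every relation, so it
  -- descends along `skeletonMap`.
  have fac (s : PushoutCocone (attachRelations X) (Limits.Sigma.map fun _ => circle.fold)) :
      ∃ d : X ⟶ s.pt, skeletonMap X ≫ d = s.inl :=
    exists_factor_of_full (skeletonMap_bijective X) (skeletonMap_full X) s.inl
      (map_eq_of_relations X s.condition)
  choose d hd using fac
  refine ⟨⟨presentation_w X⟩, ⟨PushoutCocone.IsColimit.mk _ d hd (fun s => ?_)
    fun s m hm _ => ?_⟩⟩
  · rw [← cancel_epi (Limits.Sigma.map fun _ => circle.fold), ← Category.assoc,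
      ← presentation_w, Category.assoc, hd, s.condition]
  · rw [← cancel_epi (skeletonMap X), hm, hd]

/-- Every groupoid is a two-dimensional CW-complex. -/
lemma isCWComplex_two : IsCWComplex 2 X :=
  isCWComplex_of_isPushout circle.isSphere circle.fold_injective (isCWComplex_skeleton X)
    (presentation_isPushout X)

end Presentation

end FormalCW

theorem mainTheorem5 (X : Cat.{u, u}) :
    (FormalCW.IsCWComplex 2 X ↔ IsGroupoid X) ∧
    ((∃ Z : Cat.{u, u}, FormalCW.IsCWComplex 2 Z ∧ FormalCW.WeaklyEquivalent X Z) ↔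
      IsGroupoid X) :=
  ⟨⟨fun h => h.isGroupoid, fun _ => FormalCW.isCWComplex_two X⟩,
    ⟨fun ⟨_, hZ, h⟩ => h.isGroupoid_iff.2 hZ.isGroupoid,
      -- The groupoid is itself a CW-complex, so the trivial zigzag suffices.
      fun _ => ⟨X, FormalCW.isCWComplex_two X, Relation.EqvGen.refl X⟩⟩⟩
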